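/- Let $x_1,\dots,x_n$ be Boolean variables. A $k$-CNF is an ordered sequence of clauses, each of which is a disjunction of at most $k$ literals. A restriction is an element $\rho\in\{0,1,\ast\}^n$; $F\upharpoonright\rho$ is the CNF obtained by fixing $x_i$ to $\rho(i)$ whenever $\rho(i)\in\{0,1\}$ (clauses with a true literal become identically 1, false literals are deleted, and the order of the clauses is kept), and $(F_1,\dots,F_M)\upharpoonright\rho=(F_1\upharpoonright\rho,\dots,F_M\upharpoonright\rho)$. Let $\mathcal R_p$ be the random restriction which independently sets each $x_i$ to $\ast$ with probability $p$ and to $0$ and to $1$ with probability $(1-p)/2$ each, where $0\le p\le 1$. The canonical decision tree $\mathrm{CDT}(F)$ is the constant $0$ if some clause of $F$ is identically 0, and the constant $1$ if all clauses are identically 1. Otherwise it exhaustively queries all variables of the first clause that is not identically 1, and continues with $\mathrm{CDT}(F\upharpoonright\eta)$ after the answers $\eta$. A path $\eta$ from the root in $\mathrm{CDT}(F)$ (which need not reach a leaf) is full if it ends at the end of such a round of queries, i.e. it is a nonempty concatenation of segments $\eta^{(1)}\circ\dots\circ\eta^{(u)}$, each of which assigns all the surviving variables of the first clause that is not identically 1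 after the preceding segments. For an ordered collection $\mathscr F=(F_1,\dots,F_M)$ of $k$-CNFs, the set $\mathrm{CCDT}_\ell(\mathscr F)$ of canonical common $\ell$-partial decision trees is defined inductively. (0) If $M=0$, it contains only the empty tree, which makes no queries and has depth $0$. (1) If $M\ge1$ and $\mathrm{depth}(\mathrm{CDT}(F_1))\le\ell$, it equals $\mathrm{CCDT}_\ell(F_2,\dots,F_M)$. (2) Otherwise, it consists of all trees obtained by choosing a full path $\eta$ in $\mathrm{CDT}(F_1)$ of length between $\ell+1$ and $\ell+k$, exhaustively querying all variables on $\eta$, and attaching, after each possible tuple $\pi$ of answers, some tree from $\mathrm{CCDT}_\ell(\mathscr F\upharpoonright\pi)$. Let $\mathrm{depth}(\mathrm{CCDT}_\ell(\mathscr F))$ be the maximum depth of a tree in this set. Theorem. Let $\mathscr F=(F_1,\dots,F_M)$ be an ordered collection of $k$-CNFs over $x_1,\dots,x_n$. Then for all integers $\ell,t\ge1$, $$\Pr_{\rho\leftarrow\mathcal R_p}\big[\,\mathrm{depth}(\mathrm{CCDT}_\ell(\mathscr F\upharpoonright\rho))\ge t\,\big]\;\le\;M^{\lceil t/\ell\rceil}\,(32pk)^t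 .$$ -/

import Mathlib

namespace MultiSwitching

/-- A restriction of `x_1, …, x_n`: an element of `{0, 1, ∗}^n`, with `none` playing the role of `∗`. -/
abbrev Restriction (n : ℕ) := Fin n → Option Bool

/-- The literal `(i, b)` is true exactly when `x_i = b`. -/
abbrev Literal (n : ℕ) := Fin n × Bool

/-- A clause: a disjunction of finitely many literals. -/
abbrev Clause (n : ℕ) := Finset (Literal n)

/-- A CNF formula, viewed as an ordered sequence of clauses. -/
abbrev CNF (n : ℕ) := List (Clause n)

variable {n : ℕ} {α : Type}

/-- A `k`-CNF: every clause has at most `k` literals. -/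
def IsKCNF (k : ℕ) (F : CNF n) : Prop := ∀ C ∈ F, C.card ≤ k

/-- The truth value of a clause at a total assignment. -/
def Holds (C : Clause n) (x : Fin n → Bool) : Prop := ∃ l ∈ C, x l.1 = l.2

def IdenticallyOne (C : Clause n) : Prop := ∀ x, Holds C x

def IdenticallyZero (C : Clause n) : Prop := ∀ x, ¬ Holds C x

/-- The variables of a clause, in increasing order. -/
def clauseVars (C : Clause n) : List (Fin n) := (C.image Prod.fst).sort (· ≤ ·)

/-- The variables of a formula. -/
def cnfVars (F : CNF n) : Finset (Fin n) := F.toFinset.biUnion fun C => C.image Prod.fst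

/-- Some literal of `C` is set to true by `ρ`. -/
def SatisfiedBy (ρ : Restriction n) (C : Clause n) : Prop := ∃ l ∈ C, ρ l.1 = some l.2

open Classical in
/-- The formula `F ↾ ρ`: clauses with a true literal are identically 1 and disappear; in the other
clauses the fixed (hence false) literals disappear. The order of the clauses is kept. -/
noncomputable def restrict (F : CNF n) (ρ : Restriction n) : CNF n :=
  (F.filter fun C => ¬ SatisfiedBy ρ C).map fun C => C.filter fun l => ρ l.1 = none

/-- The restriction that fixes the variables in `vs` as `a` does, and no others. -/
def fixing (vs : List (Fin n)) (a : Fin n → Bool) : Restriction n :=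
  fun i => if i ∈ vs then some (a i) else none

open Classical in
/-- The clause that the canonical decision tree queries first: none if some clause is
identically 0 or all clauses are identically 1, and otherwise the first clause that is not
identically 1. -/
noncomputable def nextClause (F : CNF n) : Option (Clause n) :=
  if ∃ C ∈ F, IdenticallyZero C then none else F.find? fun C => ¬ IdenticallyOne C

/-- Decision trees over `x_1, …, x_n` with leaves labelled by `α`. -/
inductive DTree (n : ℕ) (α : Type) : Type where
  | leaf (c : α) : DTree n α
  | node (i : Fin n) (child : Bool → DTree n α) : DTree n α

/-- The maximal number of queries on a root-to-leaf path. -/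
def DTree.depth : DTree n α → ℕ
  | .leaf _ => 0
  | .node _ child => max (child false).depth (child true).depth + 1

/-- A path of `T` that starts at the root (and may stop before a leaf), recorded as the list of
the variables queried together with the answers. -/
def DTree.IsPath : DTree n α → List (Fin n × Bool) → Prop
  | _, [] => True
  | .leaf _, _ :: _ => False
  | .node i child, q :: η => q.1 = i ∧ (child q.2).IsPath η

/-- Exhaustively query the variables in `vs` (a list without repetitions), in this order, and
continue with the tree `next a` after the answers `a i` for `i ∈ vs`; the values of `a` outside
`vs` are immaterial (set to `false`). -/
def query : List (Fin n) → ((Fin n → Bool) → DTree n α) → DTree n α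
  | [], next => next fun _ => false
  | i :: vs, next => .node i fun b => query vs fun a => next (Function.update a i b)

theorem mem_cnfVars {F : CNF n} {i : Fin n} : i ∈ cnfVars F ↔ ∃ C ∈ F, ∃ l ∈ C, l.1 = i := by
  simp [cnfVars]

theorem mem_clauseVars {C : Clause n} {i : Fin n} : i ∈ clauseVars C ↔ ∃ l ∈ C, l.1 = i := by
  simp [clauseVars]

theorem nextClause_spec {F : CNF n} {C : Clause n} (h : nextClause F = some C) :
    C ∈ F ∧ C.Nonempty := by
  unfold nextClause at h
  split_ifs at h with h0
  have hC : C ∈ F := List.mem_of_find?_eq_some h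
  refine ⟨hC, Finset.nonempty_iff_ne_empty.2 ?_⟩
  rintro rfl
  exact h0 ⟨∅, hC, by simp [IdenticallyZero, Holds]⟩

/-- Fixing the variables of the next clause leaves strictly fewer variables. -/
theorem card_cnfVars_restrict_lt {F : CNF n} {C : Clause n} (h : nextClause F = some C)
    (a : Fin n → Bool) :
    (cnfVars (restrict F (fixing (clauseVars C) a))).card < (cnfVars F).card := by
  obtain ⟨hC, l, hl⟩ := nextClause_spec h
  refine Finset.card_lt_card ((Finset.ssubset_iff_of_subset ?_).2 ⟨l.1, ?_, ?_⟩)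
  · intro i
    simp only [mem_cnfVars, restrict, List.mem_map, List.mem_filter]
    rintro ⟨_, ⟨D, ⟨hD, -⟩, rfl⟩, m, hm, rfl⟩
    exact ⟨D, hD, m, (Finset.mem_filter.1 hm).1, rfl⟩
  · exact mem_cnfVars.2 ⟨C, hC, l, hl, rfl⟩
  · simp only [mem_cnfVars, restrict, List.mem_map, List.mem_filter]
    rintro ⟨_, ⟨D, -, rfl⟩, m, hm, hml⟩
    have h1 := (Finset.mem_filter.1 hm).2
    rw [hml, fixing, if_pos (mem_clauseVars.2 ⟨l, hl, rfl⟩)] at h1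
    cases h1

open Classical in
/-- The canonical decision tree of `F`. -/
noncomputable def cdt (F : CNF n) : DTree n Bool :=
  match h : nextClause F with
  | none => .leaf (decide (¬ ∃ C ∈ F, IdenticallyZero C))
  | some C => query (clauseVars C) fun a => cdt (restrict F (fixing (clauseVars C) a))
termination_by (cnfVars F).card
decreasing_by exact card_cnfVars_restrict_lt h a

/-- The answers `a` to the queries `vs`, as a path segment. -/
def segment (vs : List (Fin n)) (a : Fin n → Bool) : List (Fin n × Bool) :=
  vs.map fun i => (i, a i)

/-- `η` is a nonempty concatenation of segments, each of which fixes all the surviving variables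
of the first clause that is not identically 1 under the segments before it. -/
inductive IsFull : CNF n → List (Fin n × Bool) → Prop where
  | last (F : CNF n) (C : Clause n) (a : Fin n → Bool) (h : nextClause F = some C) :
      IsFull F (segment (clauseVars C) a)
  | append (F : CNF n) (C : Clause n) (a : Fin n → Bool) (η : List (Fin n × Bool))
      (h : nextClause F = some C) (hη : IsFull (restrict F (fixing (clauseVars C) a)) η) :
      IsFull F (segment (clauseVars C) a ++ η)

/-- The set of full paths of length between `ℓ + 1` and `ℓ + k` in the canonical decision tree. -/
def witnessPaths (k ℓ : ℕ) (F : CNF n) : Set (List (Fin n × Bool)) :=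
  {η | (cdt F).IsPath η ∧ IsFull F η ∧ ℓ + 1 ≤ η.length ∧ η.length ≤ ℓ + k}

/-- The restriction of every formula of an ordered collection. -/
noncomputable def restrictAll (Fs : List (CNF n)) (ρ : Restriction n) : List (CNF n) :=
  Fs.map fun F => restrict F ρ

/-- `IsCCDT k ℓ Fs T`: the tree `T` is a canonical common `ℓ`-partial decision tree for the ordered
collection `Fs` of `k`-CNFs. The leaves of these trees carry no labels. -/
inductive IsCCDT (k ℓ : ℕ) : List (CNF n) → DTree n Unit → Prop where
  | empty : IsCCDT k ℓ [] (.leaf ())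
  | skip (F : CNF n) (Fs : List (CNF n)) (T : DTree n Unit)
      (h : (cdt F).depth ≤ ℓ) (hT : IsCCDT k ℓ Fs T) : IsCCDT k ℓ (F :: Fs) T
  | branch (F : CNF n) (Fs : List (CNF n)) (η : List (Fin n × Bool))
      (T : Restriction n → DTree n Unit)
      (h : ℓ < (cdt F).depth) (hη : η ∈ witnessPaths k ℓ F)
      (hT : ∀ a : Fin n → Bool,
        IsCCDT k ℓ (restrictAll (F :: Fs) (fixing (η.map Prod.fst) a))
          (T (fixing (η.map Prod.fst) a))) :
      IsCCDT k ℓ (F :: Fs)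
        (query (η.map Prod.fst) fun a => T (fixing (η.map Prod.fst) a))

/-- The set of canonical common `ℓ`-partial decision trees for `Fs`. -/
def CCDT (k ℓ : ℕ) (Fs : List (CNF n)) : Set (DTree n Unit) := {T | IsCCDT k ℓ Fs T}

/-- The maximum depth of a tree in `CCDT k ℓ Fs`. -/
noncomputable def ccdtDepth (k ℓ : ℕ) (Fs : List (CNF n)) : ℕ∞ :=
  ⨆ T ∈ CCDT k ℓ Fs, (T.depth : ℕ∞)

/-- The probability of `ρ` under the random restriction that, independently for each variable,
is `∗` with probability `p` and `0` and `1` with probability `(1 - p) / 2` each. -/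
noncomputable def weight (p : ℝ) (ρ : Restriction n) : ℝ :=
  ∏ i, if ρ i = none then p else (1 - p) / 2

open Classical in
/-- The probability of an event under the random restriction with star probability `p`. -/
noncomputable def restrictionProb (p : ℝ) (E : Set (Restriction n)) : ℝ :=
  ∑ ρ : Restriction n, if ρ ∈ E then weight p ρ else 0

end MultiSwitching

/-!
The proof is Razborov's encoding argument for the switching lemma. Call `ρ` bad if some canonical
common decision tree of the restricted formulas has depth at least `t`, and follow a path of length
`t` in that tree. Its stages are full paths in the canonical decision trees of single formulas. Fix
the `t` variables queried so as to falsify the literals of the clauses met on these full paths; this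
turns `ρ` into a restriction `ρ'` with `t` fewer stars.

A decoder recovers `ρ` from `ρ'` and little advice. Falsifying literals satisfies no clause, so
the first clause not identically 1 under `ρ'` is the first one met, even when it is only partly
fixed (`firstAlive_eq_of_extends`). The positions of the queried variables in this clause reveal the
variables. Once their values are replaced by those on the full path, the next clause comes into
sight; at the end of a stage, the values on the full path give way to those on the path in the
common tree (`exists_word_isFull`, `exists_code`). For each variable the advice is its position, the
two values, and whether it opens a clause or a stage: one of `12 k` symbols. For each stage it is
the index of the formula, and as every stage but the last has more than `ℓ` variables, there are at
most `⌈t / ℓ⌉` stages.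

The encoding is injective and satisfies `weight p ρ * ((1 - p) / 2) ^ t = p ^ t * weight p ρ'`, so
the bad restrictions have probability at most `M ^ ⌈t / ℓ⌉ * (24 p k / (1 - p)) ^ t`
(`restrictionProb_mul_le`). This suffices if `p ≤ 1 / 4`; if `p > 1 / 4`, the bound asked for is at
least 1 as soon as there is a bad restriction at all.
-/

namespace MultiSwitching

variable {n k : ℕ}

/-! ### Restrictions and the clauses they leave alive -/

/-- The restriction `θ`, with the variables in `vs` set (or reset) to their values under `a`. -/
def overwrite (θ : Restriction n) (vs : List (Fin n)) (a : Fin n → Bool) : Restriction n :=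
  fun i => if i ∈ vs then some (a i) else θ i

theorem overwrite_of_mem {θ : Restriction n} {vs : List (Fin n)} {a : Fin n → Bool} {i : Fin n}
    (h : i ∈ vs) : overwrite θ vs a i = some (a i) := if_pos h

theorem overwrite_of_notMem {θ : Restriction n} {vs : List (Fin n)} {a : Fin n → Bool}
    {i : Fin n} (h : i ∉ vs) : overwrite θ vs a i = θ i := if_neg h

@[simp]
theorem overwrite_nil (θ : Restriction n) (a : Fin n → Bool) : overwrite θ [] a = θ := by
  funext i; simp [overwrite]

theorem overwrite_cons (θ : Restriction n) (v : Fin n) (vs : List (Fin n)) (a : Fin n → Bool) :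
    overwrite θ (v :: vs) a = overwrite (Function.update θ v (some (a v))) vs a := by
  funext i
  by_cases hi : i ∈ vs
  · simp [overwrite, hi]
  · by_cases hv : i = v
    · subst hv; simp [overwrite, hi]
    · simp [overwrite, hi, hv]

theorem overwrite_append (θ : Restriction n) (us vs : List (Fin n)) (a : Fin n → Bool) :
    overwrite θ (us ++ vs) a = overwrite (overwrite θ us a) vs a := by
  funext i
  by_cases hv : i ∈ vs <;> by_cases hu : i ∈ us <;> simp [overwrite, hv, hu]

/-- A clause not satisfied by `ρ` is identically 1 on the variables that `ρ` leaves free only if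
it is identically 1 to begin with. -/
theorem identicallyOne_filter_iff {ρ : Restriction n} {D : Clause n} (hD : ¬ SatisfiedBy ρ D) :
    IdenticallyOne (D.filter fun l => ρ l.1 = none) ↔ IdenticallyOne D := by
  constructor
  · intro h x
    obtain ⟨l, hl, hx⟩ := h x
    exact ⟨l, (Finset.mem_filter.1 hl).1, hx⟩
  · intro h x
    obtain ⟨l, hl, hx⟩ := h fun i => (ρ i).getD (x i)
    cases hρ : ρ l.1 with
    | none => exact ⟨l, Finset.mem_filter.2 ⟨hl, hρ⟩, by simpa [hρ] using hx⟩
    | some b => exact absurd ⟨l, hl, by simpa [hρ] using hx⟩ hD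

/-- Restricting by `θ` and then fixing variables that `θ` leaves free is restricting once. -/
theorem restrict_restrict_fixing (F : CNF n) {θ : Restriction n} {vs : List (Fin n)}
    (a : Fin n → Bool) (hvs : ∀ v ∈ vs, θ v = none) :
    restrict (restrict F θ) (fixing vs a) = restrict F (overwrite θ vs a) := by
  have key : ∀ i b, overwrite θ vs a i = some b ↔
      θ i = some b ∨ θ i = none ∧ fixing vs a i = some b := by
    intro i b
    by_cases hi : i ∈ vs
    · simp [overwrite, fixing, hi, hvs i hi]
    · simp [overwrite, fixing, hi]
  have key' : ∀ i, overwrite θ vs a i = none ↔ θ i = none ∧ fixing vs a i = none := by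
    intro i
    by_cases hi : i ∈ vs <;> simp [overwrite, fixing, hi]
  have hsat : ∀ D : Clause n, SatisfiedBy (overwrite θ vs a) D ↔
      SatisfiedBy θ D ∨ SatisfiedBy (fixing vs a) (D.filter fun l => θ l.1 = none) := by
    intro D
    simp only [SatisfiedBy, key, Finset.mem_filter]
    constructor
    · rintro ⟨l, hl, h | h⟩
      · exact Or.inl ⟨l, hl, h⟩
      · exact Or.inr ⟨l, ⟨hl, h.1⟩, h.2⟩
    · rintro (⟨l, hl, h⟩ | ⟨l, hl, h⟩)
      · exact ⟨l, hl, Or.inl h⟩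
      · exact ⟨l, hl.1, Or.inr ⟨hl.2, h⟩⟩
  simp only [restrict, List.filter_map, List.map_map, List.filter_filter]
  congr 1
  · funext D
    ext l
    simp [key', and_assoc]
  · refine List.filter_congr fun D _ => ?_
    rw [Bool.eq_iff_iff]
    simp only [Function.comp_apply, Bool.and_eq_true, decide_eq_true_eq, hsat]
    tauto

open Classical in
/-- The first clause of `F` that is not identically 1 under `ρ`, with all of its original
literals. -/
noncomputable def firstAlive (F : CNF n) (ρ : Restriction n) : Option (Clause n) :=
  F.find? fun D => ¬ SatisfiedBy ρ D ∧ ¬ IdenticallyOne D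

/-- The clause that the canonical decision tree of `F ↾ θ` queries next is what `θ` leaves of the
first clause of `F` alive under `θ`; since it is not identically 1, it can be falsified. -/
theorem exists_firstAlive_of_nextClause {F : CNF n} {θ : Restriction n} {C : Clause n}
    (h : nextClause (restrict F θ) = some C) :
    ∃ D, firstAlive F θ = some D ∧ C = (D.filter fun l => θ l.1 = none) ∧
      ∃ x : Fin n → Bool, ∀ l ∈ C, x l.1 ≠ l.2 := by
  classical
  unfold nextClause at h
  split_ifs at h
  have hC := List.find?_some h
  rw [restrict, List.find?_map, List.find?_filter, Option.map_eq_some_iff] at h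
  obtain ⟨D, hD, rfl⟩ := h
  refine ⟨D, ?_, by ext; simp, ?_⟩
  · rw [firstAlive, ← hD]
    congr 1
    funext E
    by_cases hE : SatisfiedBy θ E
    · simp [hE]
    · simp [hE, ← identicallyOne_filter_iff hE]
  · simp only [decide_eq_true_eq, IdenticallyOne, Holds, not_forall, not_exists, not_and] at hC
    exact hC

/-- The decoder finds the right clause: passing from `θ` to an extension `ρ` does not change the
first alive clause, as long as `ρ` satisfies no literal of that clause. -/
theorem firstAlive_eq_of_extends {F : CNF n} {θ ρ : Restriction n} {D : Clause n}
    (h : firstAlive F θ = some D) (hρ : ∀ i, θ i ≠ none → ρ i = θ i)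
    (hD : ∀ l ∈ D, θ l.1 = none → ρ l.1 ≠ some l.2) : firstAlive F ρ = some D := by
  classical
  rw [firstAlive, List.find?_eq_some_iff_append] at h ⊢
  obtain ⟨h1, as, bs, rfl, h2⟩ := h
  simp only [decide_eq_true_eq] at h1
  refine ⟨?_, as, bs, rfl, fun E hE => ?_⟩
  · simp only [decide_eq_true_eq]
    refine ⟨?_, h1.2⟩
    rintro ⟨l, hl, hs⟩
    by_cases hn : θ l.1 = none
    · exact hD l hl hn hs
    · exact h1.1 ⟨l, hl, by rw [← hρ _ hn, hs]⟩
  · have := h2 E hE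
    simp only [Bool.not_eq_true', decide_eq_false_iff_not, not_and, not_not] at this ⊢
    intro hs
    refine this fun ⟨l, hl, hθ⟩ => hs ⟨l, hl, ?_⟩
    rw [hρ _ (by simp [hθ]), hθ]

/-! ### The decoder -/

/-- What a symbol of the code announces: that its variable belongs to the same clause as the
one before, that it opens the next clause of the current full path, or that it opens the next
full path. -/
inductive Mark
  | same
  | clause
  | stage
  deriving DecidableEq

instance : Fintype Mark := ⟨{.same, .clause, .stage}, by rintro (_ | _ | _) <;> simp⟩

/-- A symbol of the code, one for each variable queried: the position of the variable in its
clause, a mark, and the value of the variable on the full path and on the path in the common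
decision tree. -/
abbrev Symbol (k : ℕ) := Fin k × Mark × Bool × Bool

theorem card_symbol (k : ℕ) : Fintype.card (Symbol k) = 12 * k := by
  have : Fintype.card Mark = 3 := rfl
  simp only [Fintype.card_prod, Fintype.card_fin, Fintype.card_bool, this]
  ring

/-- The state of the decoder. It knows the formula whose decision tree is being traversed, and
the formulas of the stages to come. The three restrictions agree with the encoded restriction on
the variables not yet decoded; on the decoded variables of the current stage, `path` follows the
full path, `start` follows it up to the start of the current clause only, and `answers` follows
the common decision tree. -/
structure Decoder (n : ℕ) where
  formula : CNF n
  queue : List (CNF n)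
  start : Restriction n
  path : Restriction n
  answers : Restriction n

/-- The change of state that a mark asks for. -/
def Decoder.advance (s : Decoder n) : Mark → Decoder n
  | .same => s
  | .clause => { s with start := s.path }
  | .stage => ⟨s.queue.headD [], s.queue.tail, s.answers, s.answers, s.answers⟩

/-- The variable at position `i` of the current clause. -/
noncomputable def Decoder.variableAt (s : Decoder n) (i : ℕ) : Option (Fin n) :=
  (firstAlive s.formula s.start).bind fun D => (clauseVars D)[i]?

/-- The state after the values `b` on the full path and `a` on the common decision tree have been
decoded for the variables `vs`. -/
def Decoder.record (s : Decoder n) (vs : List (Fin n)) (b a : Fin n → Bool) : Decoder n :=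
  { s with path := overwrite s.path vs b, answers := overwrite s.answers vs a }

/-- The list of the variables that a code word describes. -/
noncomputable def decode : List (Symbol k) → Decoder n → List (Fin n)
  | [], _ => []
  | (i, m, b, a) :: w, s =>
    match (s.advance m).variableAt i with
    | none => []
    | some v => v :: decode w ((s.advance m).record [v] (fun _ => b) fun _ => a)

theorem decode_cons {i : Fin k} {m : Mark} {v : Fin n} {s : Decoder n} {b a : Fin n → Bool}
    {w : List (Symbol k)} (h : (s.advance m).variableAt i = some v) :
    decode ((i, m, b v, a v) :: w) s = v :: decode w ((s.advance m).record [v] b a) := by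
  have : (s.advance m).record [v] (fun _ => b v) (fun _ => a v) = (s.advance m).record [v] b a := by
    simp [Decoder.record, overwrite_cons]
  simp [decode, h, this]

theorem Decoder.record_cons (s : Decoder n) (v : Fin n) (vs : List (Fin n)) (b a : Fin n → Bool) :
    s.record (v :: vs) b a = (s.record [v] b a).record vs b a := by
  simp [Decoder.record, overwrite_cons]

theorem exists_position {D : Clause n} (hD : D.card ≤ k) {v : Fin n} (hv : v ∈ clauseVars D) :
    ∃ i : Fin k, (clauseVars D)[(i : ℕ)]? = some v := by
  obtain ⟨i, hi, rfl⟩ := List.mem_iff_getElem.1 hv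
  refine ⟨⟨i, hi.trans_le ?_⟩, by simp⟩
  rw [clauseVars, Finset.length_sort]
  exact Finset.card_image_le.trans hD

theorem exists_word_same {D : Clause n} (hD : D.card ≤ k) (b a : Fin n → Bool)
    (vs : List (Fin n)) (hvs : ∀ v ∈ vs, v ∈ clauseVars D) :
    ∃ w : List (Symbol k), w.length = vs.length ∧ ∀ (s : Decoder n) (w' : List (Symbol k)),
      firstAlive s.formula s.start = some D →
      decode (w ++ w') s = vs ++ decode w' (s.record vs b a) := by
  induction vs with
  | nil => exact ⟨[], rfl, fun s w' _ => by simp [Decoder.record]⟩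
  | cons v vs ih =>
    obtain ⟨w, hw, h⟩ := ih fun u hu => hvs u (List.mem_cons_of_mem _ hu)
    obtain ⟨i, hi⟩ := exists_position hD (hvs v List.mem_cons_self)
    refine ⟨(i, .same, b v, a v) :: w, by simp [hw], fun s w' hs => ?_⟩
    rw [List.cons_append, decode_cons (v := v), s.record_cons v vs, List.cons_append]
    · exact congrArg _ (h _ _ hs)
    · simp [Decoder.variableAt, Decoder.advance, hs, hi]

/-- A nonempty list of variables of the first alive clause can be encoded, behind any mark. -/
theorem exists_word_clause {D : Clause n} (hD : D.card ≤ k) (b a : Fin n → Bool) (m : Mark)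
    {vs : List (Fin n)} (hne : vs ≠ []) (hvs : ∀ v ∈ vs, v ∈ clauseVars D) :
    ∃ w : List (Symbol k), w.length = vs.length ∧ ∀ (s : Decoder n) (w' : List (Symbol k)),
      firstAlive (s.advance m).formula (s.advance m).start = some D →
      decode (w ++ w') s = vs ++ decode w' ((s.advance m).record vs b a) := by
  obtain ⟨v, vs, rfl⟩ := List.exists_cons_of_ne_nil hne
  obtain ⟨w, hw, h⟩ := exists_word_same hD b a vs fun u hu => hvs u (List.mem_cons_of_mem _ hu)
  obtain ⟨i, hi⟩ := exists_position hD (hvs v List.mem_cons_self)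
  refine ⟨(i, m, b v, a v) :: w, by simp [hw], fun s w' hs => ?_⟩
  rw [List.cons_append, decode_cons (v := v), (s.advance m).record_cons v vs,
    List.cons_append]
  · exact congrArg _ (h _ _ hs)
  · simp [Decoder.variableAt, hs, hi]

/-! ### Encoding a path of a common decision tree -/

theorem map_fst_segment (vs : List (Fin n)) (a : Fin n → Bool) :
    (segment vs a).map Prod.fst = vs := by
  simp [segment, Function.comp_def]

/-- One round of queries: if `C` is the clause that the canonical decision tree of `F ↾ θ` queries
first, then any nonempty initial part of its variables has a code word. The assignment `x`
falsifies `C`, so a decoder that starts from an extension of `θ` compatible with `x` sees the same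
clause. -/
theorem exists_word_nextClause {F : CNF n} (hF : IsKCNF k F) (a : Fin n → Bool)
    {θ : Restriction n} {C : Clause n} (h : nextClause (restrict F θ) = some C) :
    (clauseVars C).Nodup ∧ (∀ v ∈ clauseVars C, θ v = none) ∧
    ∃ x : Fin n → Bool, ∀ (b : Fin n → Bool) (m : Mark) (t : ℕ), 1 ≤ t →
      ∃ w : List (Symbol k), w.length = ((clauseVars C).take t).length ∧
        ∀ (s : Decoder n) (w' : List (Symbol k)),
        (s.advance m).formula = F → (s.advance m).start = (s.advance m).path →
        (∀ v, θ v ≠ none → (s.advance m).path v = θ v) →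
        (∀ v ∈ clauseVars C, ∀ c, (s.advance m).path v = some c → c = x v) →
        decode (w ++ w') s = (clauseVars C).take t ++
          decode w' ((s.advance m).record ((clauseVars C).take t) b a) := by
  obtain ⟨-, l₀, hl₀⟩ := nextClause_spec h
  obtain ⟨D, hD, rfl, x, hx⟩ := exists_firstAlive_of_nextClause h
  have hne : clauseVars (D.filter fun l => θ l.1 = none) ≠ [] :=
    List.ne_nil_of_mem (mem_clauseVars.2 ⟨l₀, hl₀, rfl⟩)
  have hDF : D ∈ F := List.mem_of_find?_eq_some hD
  refine ⟨Finset.sort_nodup _ _, ?_, x, fun b m t ht => ?_⟩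
  · intro v hv
    obtain ⟨l, hl, rfl⟩ := mem_clauseVars.1 hv
    exact (Finset.mem_filter.1 hl).2
  · obtain ⟨w, hw, hdec⟩ := exists_word_clause (hF D hDF) b a m
      (vs := (clauseVars (D.filter fun l => θ l.1 = none)).take t)
      (by simpa [List.take_eq_nil_iff, hne] using (by omega : t ≠ 0)) (by
        intro v hv
        obtain ⟨l, hl, rfl⟩ := mem_clauseVars.1 (List.mem_of_mem_take hv)
        exact mem_clauseVars.2 ⟨l, (Finset.mem_filter.1 hl).1, rfl⟩)
    refine ⟨w, hw, fun s w' h1 h2 h3 h4 => hdec s w' ?_⟩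
    rw [h1, h2]
    refine firstAlive_eq_of_extends hD h3 fun l hl hn hs => ?_
    have hlC : l ∈ D.filter fun l => θ l.1 = none := Finset.mem_filter.2 ⟨hl, hn⟩
    exact hx l hlC (h4 _ (mem_clauseVars.2 ⟨l, hlC, rfl⟩) _ hs).symm

/-- One stage of the code: the first `t` variables of a full path `η` of the canonical decision
tree of `F ↾ θ` have a code word `w`. The assignment `σ` falsifies the literals of the clauses met
along `η`, so a decoder that starts from any extension of `θ` compatible with `σ` still sees these
clauses. -/
theorem exists_word_isFull {F : CNF n} (hF : IsKCNF k F) (a : Fin n → Bool) {G : CNF n}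
    {η : List (Fin n × Bool)} (hη : IsFull G η) (θ : Restriction n) (hG : G = restrict F θ) :
    (η.map Prod.fst).Nodup ∧ (∀ v ∈ η.map Prod.fst, θ v = none) ∧
    ∃ σ : Fin n → Bool, ∀ (m : Mark) (t : ℕ), 1 ≤ t → t ≤ η.length →
      ∃ w : List (Symbol k), w.length = t ∧ ∀ (s : Decoder n) (w' : List (Symbol k)),
        (s.advance m).formula = F → (s.advance m).start = (s.advance m).path →
        (∀ v, θ v ≠ none → (s.advance m).path v = θ v) →
        (∀ v ∈ η.map Prod.fst, ∀ b, (s.advance m).path v = some b → b = σ v) →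
        ∃ s' : Decoder n, s'.queue = (s.advance m).queue ∧
          s'.answers = overwrite (s.advance m).answers ((η.map Prod.fst).take t) a ∧
          decode (w ++ w') s = (η.map Prod.fst).take t ++ decode w' s' := by
  induction hη generalizing θ with
  | last G C a₁ h =>
    subst hG
    obtain ⟨hnd, hfree, x, hw⟩ := exists_word_nextClause hF a h
    simp only [map_fst_segment]
    refine ⟨hnd, hfree, x, fun m t ht htl => ?_⟩
    obtain ⟨w, hwl, hdec⟩ := hw a₁ m t ht
    refine ⟨w, ?_, fun s w' h1 h2 h3 h4 => ⟨_, ?_, ?_, hdec s w' h1 h2 h3 h4⟩⟩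
    · simpa [hwl, segment] using htl
    · rfl
    · rfl
  | append G C a₁ η h hη ih =>
    subst hG
    obtain ⟨hnd, hfree, x, hw⟩ := exists_word_nextClause hF a h
    obtain ⟨hnd', hfree', σ, hσ⟩ := ih _ (restrict_restrict_fixing F a₁ hfree)
    have hdisj : ∀ v ∈ η.map Prod.fst, v ∉ clauseVars C := fun v hv hvC => by
      simpa [overwrite_of_mem hvC] using hfree' v hv
    simp only [List.map_append, map_fst_segment]
    refine ⟨List.nodup_append'.2 ⟨hnd, hnd', fun v h1 h2 => hdisj v h2 h1⟩, ?_,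
      fun v => if v ∈ clauseVars C then x v else σ v, fun m t ht htl => ?_⟩
    · intro v hv
      rcases List.mem_append.1 hv with hv | hv
      · exact hfree v hv
      · rw [← hfree' v hv, overwrite_of_notMem (hdisj v hv)]
    · obtain ⟨w, hwl, hdec⟩ := hw a₁ m t ht
      by_cases hlt : t ≤ (clauseVars C).length
      · rw [List.take_append_of_le_length hlt]
        refine ⟨w, by simpa [hwl] using hlt, fun s w' h1 h2 h3 h4 =>
          ⟨_, ?_, ?_, hdec s w' h1 h2 h3 fun v hv c hc => ?_⟩⟩
        · rfl
        · rfl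
        · simpa [hv] using h4 v (List.mem_append_left _ hv) c hc
      · rw [List.take_of_length_le (by omega)] at hwl hdec
        have htl' : t - (clauseVars C).length ≤ η.length := by
          simp only [List.length_append, segment, List.length_map] at htl
          omega
        obtain ⟨w₂, hwl₂, hdec₂⟩ := hσ .clause (t - (clauseVars C).length) (by omega) htl'
        refine ⟨w ++ w₂, by rw [List.length_append]; omega, fun s w' h1 h2 h3 h4 => ?_⟩
        have hd := hdec s (w₂ ++ w') h1 h2 h3 fun v hv c hc => by
          simpa [hv] using h4 v (List.mem_append_left _ hv) c hc
        obtain ⟨s', hs'1, hs'2, hs'3⟩ := hdec₂ ((s.advance m).record (clauseVars C) a₁ a) w' h1 rfl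
          (fun v hv => by
            by_cases hvC : v ∈ clauseVars C
            · simp [Decoder.advance, Decoder.record, overwrite_of_mem hvC]
            · simp only [Decoder.advance, Decoder.record, overwrite_of_notMem hvC] at hv ⊢
              exact h3 v hv)
          (fun v hv c hc => by
            simp only [Decoder.advance, Decoder.record,
              overwrite_of_notMem (hdisj v hv)] at hc
            simpa [hdisj v hv] using h4 v (List.mem_append_right _ hv) c hc)
        rw [List.take_append, List.take_of_length_le (by omega : (clauseVars C).length ≤ t)]
        refine ⟨s', hs'1, ?_, ?_⟩
        · rw [hs'2, overwrite_append]
          rfl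
        · rw [List.append_assoc, hd, hs'3, List.append_assoc]

theorem exists_depth_query_le {α : Type} (vs : List (Fin n))
    (next : (Fin n → Bool) → DTree n α) :
    ∃ a, (query vs next).depth ≤ vs.length + (next a).depth := by
  induction vs generalizing next with
  | nil => exact ⟨fun _ => false, by simp [query]⟩
  | cons v vs ih =>
    obtain ⟨a₀, h₀⟩ := ih fun a => next (Function.update a v false)
    obtain ⟨a₁, h₁⟩ := ih fun a => next (Function.update a v true)
    rcases le_total (next (Function.update a₀ v false)).depth
      (next (Function.update a₁ v true)).depth with h | h
    · exact ⟨Function.update a₁ v true, by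
        simp only [query, DTree.depth, List.length_cons]; omega⟩
    · exact ⟨Function.update a₀ v false, by
        simp only [query, DTree.depth, List.length_cons]; omega⟩

/-- If some canonical common decision tree of the formulas restricted by `τ` has depth at least
`t`, then `τ` can be extended by an assignment `σ` to `t` free variables `V` such that the decoder
recovers `V` from the extension, a word of `t` symbols and the indices of the formulas traversed.
Every stage but the last uses up more than `ℓ` of the `t` variables, so `⌈t / ℓ⌉` indices are
enough. -/
theorem exists_code {ℓ : ℕ} {Fs : List (CNF n)} (hFs : ∀ F ∈ Fs, IsKCNF k F)
    (j₀ : Fin Fs.length) {Gs : List (CNF n)} {T : DTree n Unit} (hT : IsCCDT k ℓ Gs T)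
    (τ : Restriction n) (hGs : ∀ G ∈ Gs, ∃ j : Fin Fs.length, G = restrict (Fs.get j) τ)
    (t N : ℕ) (ht : t ≤ T.depth) (hN : t ≤ N * ℓ) :
    ∃ (V : List (Fin n)) (σ : Fin n → Bool) (w : List (Symbol k)) (J : List (Fin Fs.length)),
      V.Nodup ∧ V.length = t ∧ (∀ v ∈ V, τ v = none) ∧ w.length = t ∧ J.length = N ∧
      ∀ s : Decoder n, s.queue = J.map Fs.get → s.answers = overwrite τ V σ →
        decode w s = V := by
  rcases Nat.eq_zero_or_pos t with rfl | hpos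
  · exact ⟨[], fun _ => false, [], List.replicate N j₀, by simp [decode]⟩
  induction hT generalizing τ t N with
  | empty => simp [DTree.depth] at ht; omega
  | skip F Gs T h hT ih =>
    exact ih τ (fun G hG => hGs G (List.mem_cons_of_mem _ hG)) t N ht hN hpos
  | branch F Gs η T h hη hT ih =>
    obtain ⟨j, rfl⟩ := hGs F List.mem_cons_self
    obtain ⟨-, hfull, hlen, -⟩ := hη
    obtain ⟨a, ha⟩ := exists_depth_query_le (η.map Prod.fst)
      fun a => T (fixing (η.map Prod.fst) a)
    obtain ⟨N, rfl⟩ : ∃ N', N = N' + 1 :=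
      Nat.exists_eq_succ_of_ne_zero (by rintro rfl; omega)
    obtain ⟨hnd, hfree, σ₁, hσ₁⟩ :=
      exists_word_isFull (hFs _ (List.get_mem Fs j)) a hfull τ rfl
    set vs := η.map Prod.fst with hvs
    have hvsl : vs.length = η.length := by simp [hvs]
    by_cases hle : t ≤ η.length
    · -- The path of length `t` ends within the current stage.
      obtain ⟨w, hwl, hdec⟩ := hσ₁ .stage t hpos hle
      refine ⟨vs.take t, σ₁, w, j :: List.replicate N j, (List.take_sublist _ _).nodup hnd,
        by rw [List.length_take]; omega, fun v hv => hfree v (List.mem_of_mem_take hv), hwl,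
        by simp, fun s hs1 hs2 => ?_⟩
      have hadv : s.advance .stage = ⟨Fs.get j, (List.replicate N j).map Fs.get,
          overwrite τ (vs.take t) σ₁, overwrite τ (vs.take t) σ₁,
          overwrite τ (vs.take t) σ₁⟩ := by
        simp [Decoder.advance, hs1, hs2]
      have hdec := hdec s []
      rw [hadv] at hdec
      obtain ⟨s', -, -, h3⟩ := hdec rfl rfl
        (fun v hv => overwrite_of_notMem fun hv' => hv (hfree v (List.mem_of_mem_take hv')))
        (fun v hv b hb => by
          by_cases hvt : v ∈ vs.take t
          · simpa [overwrite_of_mem hvt, eq_comm] using hb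
          · simp [overwrite_of_notMem hvt, hfree v hv] at hb)
      simpa [decode] using h3
    · push Not at hle
      have hN' : t - η.length ≤ N * ℓ := by
        have : t ≤ N * ℓ + ℓ := by simpa [Nat.succ_mul] using hN
        omega
      obtain ⟨V, σ₂, w₂, J, hVnd, hVl, hVfree, hwl₂, hJl, hdec₂⟩ := ih a (overwrite τ vs a)
        (by
          intro G hG
          obtain ⟨G', hG', rfl⟩ := List.mem_map.1 hG
          obtain ⟨j', rfl⟩ := hGs G' hG'
          exact ⟨j', restrict_restrict_fixing _ a hfree⟩)
        (t - η.length) N (by omega) hN' (by omega)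
      have hdisj : ∀ v ∈ V, v ∉ vs := fun v hv hvs => by
        simpa [overwrite_of_mem hvs] using hVfree v hv
      obtain ⟨w, hwl, hdec⟩ := hσ₁ .stage η.length (by omega) le_rfl
      refine ⟨vs ++ V, fun v => if v ∈ vs then σ₁ v else σ₂ v, w ++ w₂, j :: J,
        List.nodup_append'.2 ⟨hnd, hVnd, fun v h1 h2 => hdisj v h2 h1⟩,
        by rw [List.length_append]; omega, ?_, by rw [List.length_append]; omega,
        by simp [hJl], fun s hs1 hs2 => ?_⟩
      · intro v hv
        rcases List.mem_append.1 hv with hv | hv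
        · exact hfree v hv
        · rw [← hVfree v hv, overwrite_of_notMem (hdisj v hv)]
      · set ρ := overwrite τ (vs ++ V) fun v => if v ∈ vs then σ₁ v else σ₂ v with hρ
        have hadv : s.advance .stage = ⟨Fs.get j, J.map Fs.get, ρ, ρ, ρ⟩ := by
          simp [Decoder.advance, hs1, hs2]
        have hdec := hdec s w₂
        rw [hadv] at hdec
        obtain ⟨s', h1, h2, h3⟩ := hdec rfl rfl
          (fun v hv => by
            change ρ v = τ v
            refine overwrite_of_notMem fun hv' => hv ?_
            rcases List.mem_append.1 hv' with hv' | hv'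
            · exact hfree v hv'
            · rw [← hVfree v hv', overwrite_of_notMem (hdisj v hv')])
          (fun v hv b hb => by
            simpa [hρ, overwrite, hv, eq_comm] using hb)
        rw [List.take_of_length_le hvsl.le] at h2 h3
        rw [h3, hdec₂ s' h1]
        rw [h2]
        funext v
        by_cases hv : v ∈ vs
        · have hvV : v ∉ V := fun hvV => hdisj v hvV hv
          simp [overwrite, hv, hvV]
        · simp [overwrite, hρ, hv]

/-! ### Counting -/

theorem sum_weight (p : ℝ) : ∑ ρ : Restriction n, weight p ρ = 1 := by
  have h := Finset.prod_univ_sum (fun _ : Fin n => (Finset.univ : Finset (Option Bool)))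
    fun _ o => if o = none then p else (1 - p) / 2
  rw [Fintype.piFinset_univ] at h
  refine h.symm.trans (Finset.prod_eq_one fun i _ => ?_)
  simp [Fintype.sum_option]
  ring

theorem weight_nonneg {p : ℝ} (hp0 : 0 ≤ p) (hp1 : p ≤ 1) (ρ : Restriction n) :
    0 ≤ weight p ρ :=
  Finset.prod_nonneg fun i _ => by split_ifs <;> linarith

/-- Fixing free variables trades factors `p` of the weight for factors `(1 - p) / 2`. -/
theorem weight_overwrite (p : ℝ) {ρ : Restriction n} {V : List (Fin n)} (σ : Fin n → Bool)
    (hnd : V.Nodup) (hfree : ∀ v ∈ V, ρ v = none) :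
    weight p ρ * ((1 - p) / 2) ^ V.length = p ^ V.length * weight p (overwrite ρ V σ) := by
  have hcard : V.toFinset.card = V.length := List.toFinset_card_of_nodup hnd
  rw [weight, weight, ← Finset.prod_mul_prod_compl V.toFinset,
    ← Finset.prod_mul_prod_compl V.toFinset (fun i => if overwrite ρ V σ i = none then _ else _),
    Finset.prod_congr rfl fun i hi => if_pos (hfree i (List.mem_toFinset.1 hi)),
    Finset.prod_congr (s₁ := V.toFinset) (f := fun i => if overwrite ρ V σ i = none then p else _)
      rfl fun i hi => if_neg (by simp [overwrite_of_mem (List.mem_toFinset.1 hi)]),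
    Finset.prod_congr (s₁ := V.toFinsetᶜ) (f := fun i => if overwrite ρ V σ i = none then p else _)
      rfl fun i hi => by
        rw [overwrite_of_notMem (by simpa using hi)],
    Finset.prod_const, Finset.prod_const, hcard]
  ring

theorem restrictionProb_le_one {p : ℝ} (hp0 : 0 ≤ p) (hp1 : p ≤ 1) (E : Set (Restriction n)) :
    restrictionProb p E ≤ 1 := by
  rw [restrictionProb, ← sum_weight (n := n) p]
  refine Finset.sum_le_sum fun ρ _ => ?_
  split_ifs
  exacts [le_rfl, weight_nonneg hp0 hp1 ρ]

/-- If each `ρ ∈ E` is recovered by `dec` from a code in `β` and some `ρ'` that fixes `t` further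
variables, then `E` has probability at most `|β| (2p / (1 - p))^t`. -/
theorem restrictionProb_mul_le {β : Type*} [Fintype β] {p : ℝ} (hp0 : 0 ≤ p) (hp1 : p ≤ 1)
    {t : ℕ} {E : Set (Restriction n)} (dec : Restriction n → β → Restriction n)
    (hE : ∀ ρ ∈ E, ∃ ρ' c, dec ρ' c = ρ ∧
      weight p ρ * ((1 - p) / 2) ^ t = p ^ t * weight p ρ') :
    restrictionProb p E * ((1 - p) / 2) ^ t ≤ Fintype.card β * p ^ t := by
  classical
  rcases E.eq_empty_or_nonempty with rfl | ⟨ρ₀, hρ₀⟩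
  · simp only [restrictionProb, Set.mem_empty_iff_false, if_false, Finset.sum_const_zero,
      zero_mul]
    positivity
  have : Nonempty β := let ⟨_, c, _⟩ := hE ρ₀ hρ₀; ⟨c⟩
  choose! f c hdec hw using hE
  calc restrictionProb p E * ((1 - p) / 2) ^ t
      = ∑ ρ with ρ ∈ E, p ^ t * weight p (f ρ) := by
        rw [restrictionProb, ← Finset.sum_filter, Finset.sum_mul]
        exact Finset.sum_congr (by ext; simp) fun ρ hρ => hw ρ (Finset.mem_filter.1 hρ).2
    _ = ∑ x ∈ (Finset.univ.filter (· ∈ E)).image fun ρ => (f ρ, c ρ), p ^ t * weight p x.1 := by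
        rw [Finset.sum_image]
        intro ρ₁ h₁ ρ₂ h₂ h
        simp only [Finset.coe_filter, Finset.mem_univ, true_and, Set.mem_ofPred_eq] at h₁ h₂
        obtain ⟨hf, hc⟩ := Prod.mk.inj h
        rw [← hdec ρ₁ h₁, ← hdec ρ₂ h₂, hf, hc]
    _ ≤ ∑ x : Restriction n × β, p ^ t * weight p x.1 :=
        Finset.sum_le_sum_of_subset_of_nonneg (Finset.subset_univ _) fun x _ _ =>
          mul_nonneg (pow_nonneg hp0 t) (weight_nonneg hp0 hp1 _)
    _ = Fintype.card β * p ^ t := by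
        rw [Fintype.sum_prod_type]
        simp [← Finset.mul_sum, sum_weight]

theorem exists_isCCDT_of_le_ccdtDepth {ℓ t : ℕ} (ht : 1 ≤ t) {Gs : List (CNF n)}
    (h : (t : ℕ∞) ≤ ccdtDepth k ℓ Gs) : ∃ T, IsCCDT k ℓ Gs T ∧ t ≤ T.depth := by
  by_contra! hc
  have h' : ccdtDepth k ℓ Gs ≤ ((t - 1 : ℕ) : ℕ∞) :=
    iSup₂_le fun T hT => Nat.cast_le.2 (Nat.le_sub_one_of_lt (hc T hT))
  have := Nat.cast_le.1 (h.trans h')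
  omega

end MultiSwitching

open MultiSwitching

theorem theorem4 (n k ℓ t : ℕ) (hℓ : 1 ≤ ℓ) (ht : 1 ≤ t)
    (p : ℝ) (hp0 : 0 ≤ p) (hp1 : p ≤ 1)
    (Fs : List (MultiSwitching.CNF n)) (hFs : ∀ F ∈ Fs, MultiSwitching.IsKCNF k F) :
    MultiSwitching.restrictionProb p
        {ρ : MultiSwitching.Restriction n |
          (t : ℕ∞) ≤ MultiSwitching.ccdtDepth k ℓ (MultiSwitching.restrictAll Fs ρ)}
      ≤ (Fs.length : ℝ) ^ ⌈(t : ℝ) / (ℓ : ℝ)⌉₊ * (32 * p * (k : ℝ)) ^ t := by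
  set N := ⌈(t : ℝ) / (ℓ : ℝ)⌉₊
  set E := {ρ : Restriction n | (t : ℕ∞) ≤ ccdtDepth k ℓ (restrictAll Fs ρ)}
  have hN : t ≤ N * ℓ := by
    have : (t : ℝ) / ℓ ≤ N := Nat.le_ceil _
    rw [div_le_iff₀ (by exact_mod_cast hℓ)] at this
    exact_mod_cast this
  -- A code consists of `t` symbols and `N` indices of formulas.
  have hcode : ∀ ρ ∈ E, ∃ (V : List (Fin n)) (σ : Fin n → Bool) (w : List (Symbol k))
      (J : List (Fin Fs.length)), V.Nodup ∧ V.length = t ∧ (∀ v ∈ V, ρ v = none) ∧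
      w.length = t ∧ J.length = N ∧ decode w
        ⟨[], J.map Fs.get, overwrite ρ V σ, overwrite ρ V σ, overwrite ρ V σ⟩ = V := by
    intro ρ hρ
    obtain ⟨T, hT, htT⟩ := exists_isCCDT_of_le_ccdtDepth ht hρ
    have hpos : 0 < Fs.length := by
      rw [List.length_pos_iff]
      rintro rfl
      cases hT
      simp [DTree.depth] at htT
      omega
    obtain ⟨V, σ, w, J, h1, h2, h3, h4, h5, h6⟩ := exists_code hFs ⟨0, hpos⟩ hT ρ (by
      intro G hG
      obtain ⟨F, hF, rfl⟩ := List.mem_map.1 hG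
      obtain ⟨j, rfl⟩ := List.get_of_mem hF
      exact ⟨j, rfl⟩) t N htT hN
    exact ⟨V, σ, w, J, h1, h2, h3, h4, h5, h6 _ rfl rfl⟩
  rcases E.eq_empty_or_nonempty with hE | ⟨ρ₀, hρ₀⟩
  · rw [hE]
    simp only [restrictionProb, Set.mem_empty_iff_false, if_false, Finset.sum_const_zero]
    positivity
  rcases le_or_gt p (1 / 4) with hp | hp
  · let dec : Restriction n → List.Vector (Symbol k) t × List.Vector (Fin Fs.length) N →
        Restriction n := fun ρ c i =>
      if i ∈ decode c.1.toList ⟨[], c.2.toList.map Fs.get, ρ, ρ, ρ⟩ then none else ρ i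
    have hmain := restrictionProb_mul_le hp0 hp1 (t := t) (E := E) dec (by
      intro ρ hρ
      obtain ⟨V, σ, w, J, hnd, hVl, hfree, hwl, hJl, hdec⟩ := hcode ρ hρ
      refine ⟨overwrite ρ V σ, (⟨w, hwl⟩, ⟨J, hJl⟩), ?_, ?_⟩
      · funext i
        have : dec (overwrite ρ V σ) (⟨w, hwl⟩, ⟨J, hJl⟩) i =
            if i ∈ V then none else overwrite ρ V σ i := by
          simp only [dec, List.Vector.toList_mk, hdec]
        rw [this]
        split_ifs with hi
        · exact (hfree i hi).symm
        · exact overwrite_of_notMem hi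
      · rw [← hVl]
        exact weight_overwrite p σ hnd hfree)
    rw [Fintype.card_prod, card_vector, card_vector, card_symbol, Fintype.card_fin] at hmain
    push_cast at hmain
    have hq : 0 < ((1 - p) / 2) ^ t := by
      have : 0 < (1 - p) / 2 := by linarith
      positivity
    refine le_of_mul_le_mul_right (hmain.trans ?_) hq
    -- With `12k` symbols, `24 / (1 - p) ≤ 32` is what remains to check, and `p ≤ 1/4`.
    calc (12 * (k : ℝ)) ^ t * (Fs.length : ℝ) ^ N * p ^ t
        = (Fs.length : ℝ) ^ N * (12 * k * p) ^ t := by rw [mul_pow _ p]; ring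
      _ ≤ (Fs.length : ℝ) ^ N * (32 * p * k * ((1 - p) / 2)) ^ t := by
          refine mul_le_mul_of_nonneg_left (pow_le_pow_left₀ (by positivity) ?_ t) (by positivity)
          have : 0 ≤ (k : ℝ) * p * (1 - 4 * p) :=
            mul_nonneg (by positivity) (by linarith)
          nlinarith
      _ = (Fs.length : ℝ) ^ N * (32 * p * k) ^ t * ((1 - p) / 2) ^ t := by
          rw [mul_pow _ ((1 - p) / 2)]; ring
  · -- Codes exist, so there are symbols and indices: the bound exceeds 1.
    obtain ⟨-, -, w, J, -, -, -, hwl, hJl, -⟩ := hcode ρ₀ hρ₀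
    have hk : (1 : ℝ) ≤ k := by
      obtain ⟨x, w, rfl⟩ := List.exists_cons_of_length_pos (by omega : 0 < w.length)
      exact_mod_cast x.1.pos
    have hM : (1 : ℝ) ≤ Fs.length := by
      have : N ≠ 0 := by rintro h0; rw [h0] at hN; omega
      obtain ⟨j, J, rfl⟩ := List.exists_cons_of_length_pos (by omega : 0 < J.length)
      exact_mod_cast j.pos
    refine (restrictionProb_le_one hp0 hp1 E).trans ?_
    exact one_le_mul_of_one_le_of_one_le (one_le_pow₀ hM) (one_le_pow₀ (by nlinarith))
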